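/- Let $\mathfrak G=\mathbb Z[i]$ and let $f:\mathbb C\to\mathfrak G$ be any function such that $|z-f(z)|\le|z-\gamma|$ for all $z\in\mathbb C$ and $\gamma\in\mathfrak G$ (a nearest Gaussian integer map, with an arbitrary convention for breaking ties). For $z\in\mathbb C$ put $z_0=z$, $a_n=f(z_n)$ and $z_{n+1}=(z_n-a_n)^{-1}$, stopping at $n$ if $z_n=a_n$; the (finite or infinite) sequence $(a_n)_{n\ge0}$ is the Hurwitz expansion of $z$. It is infinite if $z\in\mathbb C'$, the set of complex numbers whose real or imaginary part is irrational. Let $S=\{x+iy : |x|<\tfrac12,\ |y|<\tfrac12\}$. A block $\beta=(b_1,\dots,b_l)$ with $l\ge1$, $b_j\in\mathfrak G$ and $|b_j|>1$ for all $j$, is called admissible if the set $S_\beta$ of all $z\in S$ whose Hurwitz expansion satisfies $(a_1,\dots,a_l)=\beta$ has nonempty interior. A number $z\in\mathbb C'$ is called generic if every admissible block occurs in its Hurwitz expansion, that is, for every admissible $\beta=(b_1,\dots,b_l)$ there is $k\ge0$ with $(a_k,\dots,a_{k+l-1})=\beta$. Proposition 8.5. The set of generic complex numbers contains a dense $G_\delta$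 subset of $\mathbb C$. -/

import Mathlib

namespace HurwitzCF

/-- A (single-valued) choice function of the Hurwitz algorithm: `f z` is a Gaussian integer at
minimum distance from `z`. Such an `f` amounts to a tie-breaking convention at the points having
several nearest Gaussian integers. -/
def IsHurwitzChoice (f : ℂ → GaussianInt) : Prop :=
  ∀ (z : ℂ) (γ : GaussianInt),
    ‖z - GaussianInt.toComplex (f z)‖ ≤ ‖z - GaussianInt.toComplex γ‖

/-- The iteration sequence `z₀ = z`, `zₙ₊₁ = (zₙ - f zₙ)⁻¹`. It is meaningful at index `n` only
if the algorithm has not stopped before, see `Reaches`. -/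
noncomputable def iter (f : ℂ → GaussianInt) (z : ℂ) : ℕ → ℂ
  | 0 => z
  | n + 1 => (iter f z n - GaussianInt.toComplex (f (iter f z n)))⁻¹

/-- The partial quotients `aₙ = f zₙ` of `z`. -/
noncomputable def expansion (f : ℂ → GaussianInt) (z : ℂ) (n : ℕ) : GaussianInt :=
  f (iter f z n)

/-- The algorithm started at `z` does not stop before index `n`, that is, `zₘ ≠ f zₘ` for all
`m < n`, so that `zₙ` and `aₙ` are defined. -/
def Reaches (f : ℂ → GaussianInt) (z : ℂ) (n : ℕ) : Prop :=
  ∀ m < n, GaussianInt.toComplex (f (iter f z m)) ≠ iter f z m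

/-- The set `ℂ'` of the complex numbers which are not rational, i.e. whose real or imaginary
part is irrational. On it the algorithm never stops. -/
def irrationalComplex : Set ℂ :=
  {z | Irrational z.re ∨ Irrational z.im}

/-- The open unit square `S` centred at the origin. -/
def openSquare : Set ℂ :=
  {z | |z.re| < 1 / 2 ∧ |z.im| < 1 / 2}

/-- The block `β = (b₁, …, b_l)` occurs in the sequence `a` starting at `k`. -/
def OccursAt (β : List GaussianInt) (a : ℕ → GaussianInt) (k : ℕ) : Prop :=
  ∀ (i : ℕ) (hi : i < β.length), a (k + i) = β[i]

/-- The set `S_β` of the `z ∈ S` whose Hurwitz expansion (possibly finite, but having at least the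
terms `a₀, …, a_l`) satisfies `(a₁, …, a_l) = β`. -/
def cylinder (f : ℂ → GaussianInt) (β : List GaussianInt) : Set ℂ :=
  {z | z ∈ openSquare ∧ Reaches f z β.length ∧ OccursAt β (expansion f z) 1}

/-- A block `β` (of length at least one, with entries of absolute value greater than `1`) is
admissible if `S_β` has nonempty interior. -/
def Admissible (f : ℂ → GaussianInt) (β : List GaussianInt) : Prop :=
  β ≠ [] ∧ (∀ b ∈ β, 1 < ‖GaussianInt.toComplex b‖) ∧ (interior (cylinder f β)).Nonempty

/-- A sequence is generic if every admissible block occurs in it. -/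
def IsGenericSeq (f : ℂ → GaussianInt) (a : ℕ → GaussianInt) : Prop :=
  ∀ β : List GaussianInt, Admissible f β → ∃ k : ℕ, OccursAt β a k

/-- The set of generic complex numbers: the `z ∈ ℂ'` whose Hurwitz expansion is generic. -/
def genericNumbers (f : ℂ → GaussianInt) : Set ℂ :=
  {z | z ∈ irrationalComplex ∧ IsGenericSeq f (expansion f z)}

end HurwitzCF

open Filter Topology

namespace HurwitzCF

/-! By Baire's theorem it suffices that, for each of the countably many admissible blocks, the
numbers containing it have dense interior (`dense_interior_occursAt`). Near a Gaussian rational `a /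
c`, write `z = (a t + 1) / (c t)` with `t` large. The algorithm on `z` then follows the Euclidean
algorithm on `(a, c)` and ends with an iterate affine in `t` (`exists_iter_moebius_eq_affine`). Ties
in the Euclidean steps are harmless because `t` stays in thin cones about a ray of slope `√2`, so
each limit is approached from a definite side in both coordinates. These cones contain arbitrarily
large balls, so the affine iterate covers a Gaussian translate of a point interior to the block's
cylinder. -/

lemma gaussianInt_toComplex_re (g : GaussianInt) : (GaussianInt.toComplex g).re = g.re :=
  (GaussianInt.intCast_re g).symm

lemma gaussianInt_toComplex_im (g : GaussianInt) : (GaussianInt.toComplex g).im = g.im :=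
  (GaussianInt.intCast_im g).symm

lemma iter_add (f : ℂ → GaussianInt) (z : ℂ) (n k : ℕ) :
    iter f z (n + k) = iter f (iter f z n) k := by
  induction k with
  | zero => rfl
  | succ k ih => rw [← add_assoc, iter, ih, iter]

lemma IsHurwitzChoice.eq_of_abs_lt {f : ℂ → GaussianInt} (hf : IsHurwitzChoice f) {z : ℂ}
    {g : GaussianInt} (hre : |z.re - g.re| < 1 / 2) (him : |z.im - g.im| < 1 / 2) : f z = g := by
  have h := hf z g
  rw [← sq_le_sq₀ (norm_nonneg _) (norm_nonneg _), ← Complex.normSq_eq_norm_sq,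
    ← Complex.normSq_eq_norm_sq, Complex.normSq_apply, Complex.normSq_apply] at h
  simp only [Complex.sub_re, Complex.sub_im, gaussianInt_toComplex_re,
    gaussianInt_toComplex_im] at h
  rw [abs_lt] at hre him
  -- a nonzero integer shift does not decrease the square of a number in `(-1/2, 1/2)`
  have key : ∀ (x : ℝ) (m n : ℤ), -(1 / 2) < x - n → x - n < 1 / 2 → m ≠ n →
      (x - n) * (x - n) < (x - m) * (x - m) := by
    intro x m n h1 h2 hne
    rcases lt_or_gt_of_ne hne with hlt | hlt
    · have : (m : ℝ) + 1 ≤ n := by exact_mod_cast hlt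
      nlinarith
    · have : (n : ℝ) + 1 ≤ m := by exact_mod_cast hlt
      nlinarith
  by_cases h1 : (f z).re = g.re
  · by_cases h2 : (f z).im = g.im
    · exact Zsqrtd.ext h1 h2
    · have := key z.im _ _ him.1 him.2 h2
      rw [h1] at h
      linarith
  · have h3 := key z.re _ _ hre.1 hre.2 h1
    by_cases h2 : (f z).im = g.im
    · rw [h2] at h
      linarith
    · have := key z.im _ _ him.1 him.2 h2
      linarith

/-- If `φ` tends to `x` from a definite side, it eventually has a constant nearest integer. -/
lemma exists_int_eventually_abs_sub_lt {α : Type*} {l : Filter α} {φ r : α → ℝ} {x y : ℝ}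
    (hr : Tendsto r l atTop) (hy : y ≠ 0) (h : Tendsto (fun p => r p * (φ p - x)) l (𝓝 y)) :
    ∃ k : ℤ, |x - k| ≤ 1 / 2 ∧ ∀ᶠ p in l, |φ p - k| < 1 / 2 := by
  have hφ : Tendsto φ l (𝓝 x) := by
    have h1 : Tendsto (fun p => (r p)⁻¹ * (r p * (φ p - x)) + x) l (𝓝 (0 * y + x)) :=
      (hr.inv_tendsto_atTop.mul h).add_const x
    rw [zero_mul, zero_add] at h1
    refine h1.congr' ?_
    filter_upwards [hr.eventually_gt_atTop 0] with p hp
    field_simp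
    ring
  rcases lt_or_gt_of_ne hy with hy | hy
  -- This choice gives `k - 1/2 < x ≤ k + 1/2`. At a tie `x = k + 1/2`, approach from below still
  -- gives `φ < k + 1/2`.
  · refine ⟨⌈x - 1 / 2⌉, ?_, ?_⟩
    · have := Int.le_ceil (x - 1 / 2)
      have := Int.ceil_lt_add_one (x - 1 / 2)
      rw [abs_le]
      constructor <;> linarith
    · have h1 := Int.le_ceil (x - 1 / 2)
      have h2 := Int.ceil_lt_add_one (x - 1 / 2)
      filter_upwards [h.eventually_lt_const hy, hr.eventually_gt_atTop 0,
        hφ.eventually_const_lt (show (⌈x - 1 / 2⌉ : ℝ) - 1 / 2 < x by linarith)] with p h3 h4 h5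
      have : φ p - x < 0 := by
        by_contra! hc
        exact absurd h3 (not_lt.2 (mul_nonneg h4.le hc))
      rw [abs_lt]
      constructor <;> linarith
  · refine ⟨⌊x + 1 / 2⌋, ?_, ?_⟩
    · have := Int.floor_le (x + 1 / 2)
      have := Int.lt_floor_add_one (x + 1 / 2)
      rw [abs_le]
      constructor <;> linarith
    · have h1 := Int.floor_le (x + 1 / 2)
      have h2 := Int.lt_floor_add_one (x + 1 / 2)
      filter_upwards [h.eventually_const_lt hy, hr.eventually_gt_atTop 0,
        hφ.eventually_lt_const (show x < (⌊x + 1 / 2⌋ : ℝ) + 1 / 2 by linarith)] with p h3 h4 h5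
      have : 0 < φ p - x := by
        by_contra! hc
        exact absurd h3 (not_lt.2 (mul_nonpos_of_nonneg_of_nonpos h4.le hc))
      rw [abs_lt]
      constructor <;> linarith

/-! ### Thin cones of irrational slope -/

/-- A direction in the complex plane with irrational slope. -/
noncomputable def dir : ℂ := ⟨1, √2⟩

/-- The pairs `(r, v)` with `r → ∞` and `v → dir`; the products `r * v` fill thinner and thinner
truncated cones about the ray spanned by `dir`. -/
noncomputable def conePairs : Filter (ℝ × ℂ) := atTop ×ˢ 𝓝 dir

lemma dir_ne_zero : dir ≠ 0 := fun h => by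
  have := congrArg Complex.re h
  simp [dir] at this

lemma int_add_int_mul_sqrt_two_ne_zero {x y : ℤ} (h : x ≠ 0 ∨ y ≠ 0) :
    (x : ℝ) + y * √2 ≠ 0 := by
  intro h0
  by_cases hy : y = 0
  · simp_all
  · exact (irrational_sqrt_two.intCast_mul hy).intCast_add x ⟨0, by simp [h0]⟩

/-- Up to a positive real factor the quotient is `s * star dir` with `s = e * star c`. Its
coordinates are nontrivial integer combinations of `1` and `√2`. -/
lemma div_mul_dir_re_im_ne_zero {e c : GaussianInt} (he : e ≠ 0) (hc : c ≠ 0) :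
    (GaussianInt.toComplex e / (GaussianInt.toComplex c * dir)).re ≠ 0 ∧
      (GaussianInt.toComplex e / (GaussianInt.toComplex c * dir)).im ≠ 0 := by
  have hc' : GaussianInt.toComplex c * dir ≠ 0 :=
    mul_ne_zero (by simpa using hc) dir_ne_zero
  obtain ⟨s, hs⟩ : ∃ s : GaussianInt, s = e * star c := ⟨_, rfl⟩
  have hs0 : s ≠ 0 := by rw [hs]; exact mul_ne_zero he (by simpa using hc)
  have hs1 : s.re ≠ 0 ∨ s.im ≠ 0 := by
    by_contra! h
    exact hs0 (Zsqrtd.ext h.1 h.2)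
  have heq : GaussianInt.toComplex e / (GaussianInt.toComplex c * dir) =
      (((Complex.normSq (GaussianInt.toComplex c * dir))⁻¹ : ℝ) : ℂ) *
        (GaussianInt.toComplex s * star dir) := by
    rw [hs, map_mul GaussianInt.toComplex, GaussianInt.toComplex_star, div_eq_mul_inv,
      Complex.inv_def]
    simp only [map_mul, Complex.star_def]
    ring
  have hn : (Complex.normSq (GaussianInt.toComplex c * dir))⁻¹ ≠ 0 :=
    inv_ne_zero (by simpa using hc')
  rw [heq, Complex.re_ofReal_mul, Complex.im_ofReal_mul]
  refine ⟨mul_ne_zero hn ?_, mul_ne_zero hn ?_⟩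
  · have := int_add_int_mul_sqrt_two_ne_zero hs1
    simpa [dir, Complex.mul_re] using this
  · have := int_add_int_mul_sqrt_two_ne_zero (x := s.im) (y := -s.re)
      (hs1.symm.imp id (by simpa using ·))
    convert this using 1
    simp [dir, Complex.mul_im]
    ring

lemma tendsto_fst_conePairs : Tendsto (fun p : ℝ × ℂ => p.1) conePairs atTop := tendsto_fst

lemma tendsto_inv_fst_conePairs :
    Tendsto (fun p : ℝ × ℂ => ((p.1 : ℂ))⁻¹) conePairs (𝓝 0) := by
  have := (Complex.continuous_ofReal.tendsto 0).comp tendsto_fst_conePairs.inv_tendsto_atTop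
  refine (this.congr fun p => ?_).trans (by simp)
  simp

/-- Along the cones, a Möbius transformation `t ↦ (a t + b) / (c t + d)` tends to `a / c` with
the rate `1 / r` and a definite direction. -/
lemma tendsto_mul_moebius_sub {a b c d : ℂ} (hc : c ≠ 0) :
    Tendsto (fun p : ℝ × ℂ => (p.1 : ℂ) *
      ((a * (p.1 * p.2) + b) / (c * (p.1 * p.2) + d) - a / c)) conePairs
      (𝓝 ((b * c - a * d) / (c * c * dir))) ∧
    ∀ᶠ p : ℝ × ℂ in conePairs, c * (p.1 * p.2) + d ≠ 0 := by
  have hden : Tendsto (fun p : ℝ × ℂ => c * p.2 + d * (p.1 : ℂ)⁻¹) conePairs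
      (𝓝 (c * dir + d * 0)) :=
    (tendsto_snd.const_mul c).add (tendsto_inv_fst_conePairs.const_mul d)
  rw [mul_zero, add_zero] at hden
  have hcd : c * dir ≠ 0 := mul_ne_zero hc dir_ne_zero
  have hne : ∀ᶠ p : ℝ × ℂ in conePairs, c * (p.1 * p.2) + d ≠ 0 := by
    filter_upwards [hden.eventually_ne hcd, tendsto_fst_conePairs.eventually_gt_atTop 0]
      with p h1 h2 h3
    have h2' : (p.1 : ℂ) ≠ 0 := by exact_mod_cast h2.ne'
    apply h1
    have : c * p.2 + d * (p.1 : ℂ)⁻¹ = (c * (p.1 * p.2) + d) * (p.1 : ℂ)⁻¹ := by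
      field_simp
    rw [this, h3, zero_mul]
  refine ⟨?_, hne⟩
  have hlim : Tendsto (fun p : ℝ × ℂ => (b * c - a * d) / c / (c * p.2 + d * (p.1 : ℂ)⁻¹))
      conePairs (𝓝 ((b * c - a * d) / c / (c * dir))) := (tendsto_const_nhds).div hden hcd
  rw [div_div, ← mul_assoc] at hlim
  refine hlim.congr' ?_
  filter_upwards [hne, tendsto_fst_conePairs.eventually_gt_atTop 0,
    hden.eventually_ne hcd] with p h1 h2 h3
  have h2' : (p.1 : ℂ) ≠ 0 := by exact_mod_cast h2.ne'
  have : c * p.2 + d * (p.1 : ℂ)⁻¹ = (c * (p.1 * p.2) + d) / (p.1 : ℂ) := by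
    field_simp
  rw [this, div_sub_div _ _ h1 hc, div_div_eq_mul_div, div_mul_eq_mul_div, div_div,
    mul_div_assoc', div_eq_div_iff (mul_ne_zero hc h1) (mul_ne_zero h1 hc)]
  ring

/-! ### The Euclidean algorithm along the cones -/

lemma exists_eventually_choice_moebius {f : ℂ → GaussianInt} (hf : IsHurwitzChoice f)
    {a b c d : GaussianInt} (hdet : a * d - b * c ≠ 0) (hc : c ≠ 0) :
    ∃ g : GaussianInt, (a - g * c).norm.natAbs < c.norm.natAbs ∧
      ∀ᶠ p : ℝ × ℂ in conePairs, f ((GaussianInt.toComplex a * (p.1 * p.2) +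
        GaussianInt.toComplex b) / (GaussianInt.toComplex c * (p.1 * p.2) +
        GaussianInt.toComplex d)) = g := by
  have hcC : GaussianInt.toComplex c ≠ 0 := by simpa using hc
  have hlim := (tendsto_mul_moebius_sub (a := GaussianInt.toComplex a)
    (b := GaussianInt.toComplex b) (d := GaussianInt.toComplex d) hcC).1
  have hy := div_mul_dir_re_im_ne_zero (e := b * c - a * d) (c := c * c)
    (fun h => hdet (by rw [← neg_sub, h, neg_zero])) (mul_ne_zero hc hc)
  simp only [map_sub, map_mul] at hy
  have hre := (Complex.continuous_re.tendsto _).comp hlim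
  have him := (Complex.continuous_im.tendsto _).comp hlim
  simp only [Function.comp_def, Complex.re_ofReal_mul, Complex.im_ofReal_mul, Complex.sub_re,
    Complex.sub_im] at hre him
  obtain ⟨k, hk1, hk2⟩ := exists_int_eventually_abs_sub_lt tendsto_fst_conePairs hy.1 hre
  obtain ⟨m, hm1, hm2⟩ := exists_int_eventually_abs_sub_lt tendsto_fst_conePairs hy.2 him
  refine ⟨⟨k, m⟩, ?_, ?_⟩
  -- Both coordinate errors are at most `1/2`, so the squared distance is at most `1/2 < 1`: this is
  -- Euclidean division.
  · have h1 : Complex.normSq (GaussianInt.toComplex a / GaussianInt.toComplex c -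
        GaussianInt.toComplex ⟨k, m⟩) ≤ 1 / 2 := by
      rw [Complex.normSq_apply]
      simp only [Complex.sub_re, Complex.sub_im, gaussianInt_toComplex_re,
        gaussianInt_toComplex_im]
      rw [abs_le] at hk1 hm1
      nlinarith
    have h2 : GaussianInt.toComplex (a - ⟨k, m⟩ * c) = (GaussianInt.toComplex a /
        GaussianInt.toComplex c - GaussianInt.toComplex ⟨k, m⟩) * GaussianInt.toComplex c := by
      rw [map_sub, map_mul]
      field_simp
    have h3 : Complex.normSq (GaussianInt.toComplex (a - ⟨k, m⟩ * c)) <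
        Complex.normSq (GaussianInt.toComplex c) := by
      rw [h2, Complex.normSq_mul]
      have := Complex.normSq_pos.2 hcC
      nlinarith
    rw [← GaussianInt.intCast_real_norm, ← GaussianInt.intCast_real_norm] at h3
    have h4 : (a - ⟨k, m⟩ * c).norm < c.norm := by exact_mod_cast h3
    have := GaussianInt.norm_nonneg (a - ⟨k, m⟩ * c)
    omega
  · filter_upwards [hk2, hm2] with p h1 h2
    exact hf.eq_of_abs_lt h1 h2

/-- The Hurwitz algorithm turns a Möbius transformation with Gaussian coefficients into an
affine map along the cones. -/
lemma exists_iter_moebius_eq_affine {f : ℂ → GaussianInt} (hf : IsHurwitzChoice f)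
    (a b c d : GaussianInt) (hdet : a * d - b * c ≠ 0) :
    ∃ (n : ℕ) (u v : ℂ), u ≠ 0 ∧ ∀ᶠ p : ℝ × ℂ in conePairs,
      iter f ((GaussianInt.toComplex a * (p.1 * p.2) + GaussianInt.toComplex b) /
        (GaussianInt.toComplex c * (p.1 * p.2) + GaussianInt.toComplex d)) n =
        u * (p.1 * p.2) + v := by
  induction hN : c.norm.natAbs using Nat.strong_induction_on generalizing a b c d with
  | _ N ih =>
  by_cases hc : c = 0
  · subst hc
    rw [mul_zero, sub_zero] at hdet
    have ha : GaussianInt.toComplex a ≠ 0 := by simpa using left_ne_zero_of_mul hdet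
    have hd : GaussianInt.toComplex d ≠ 0 := by simpa using right_ne_zero_of_mul hdet
    refine ⟨0, GaussianInt.toComplex a / GaussianInt.toComplex d,
      GaussianInt.toComplex b / GaussianInt.toComplex d, div_ne_zero ha hd, .of_forall fun p => ?_⟩
    simp only [iter, map_zero, zero_mul, zero_add]
    ring
  · obtain ⟨g, hg, hev⟩ := exists_eventually_choice_moebius hf hdet hc
    -- Subtracting `g` and inverting gives the matrix with rows `(c, d)` and `(a - g c, b - g d)`;
    -- the determinant only changes sign.
    obtain ⟨n, u, v, hu, hn⟩ := ih _ (hN ▸ hg) c d (a - g * c) (b - g * d)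
      (fun h => hdet (by linear_combination -h)) rfl
    refine ⟨1 + n, u, v, hu, ?_⟩
    have hcC : GaussianInt.toComplex c ≠ 0 := by simpa using hc
    filter_upwards [hev, hn, (tendsto_mul_moebius_sub (a := 0) (b := 0)
      (d := GaussianInt.toComplex d) hcC).2] with p h1 h2 h3
    rw [iter_add, ← h2]
    congr 1
    simp only [iter, h1, map_sub, map_mul]
    rw [div_sub' h3, inv_div]
    congr 1
    ring

/-- Arbitrarily far out, the cones contain arbitrarily large balls. -/
lemma exists_ball_of_eventually_conePairs {P : ℂ → Prop}
    (hP : ∀ᶠ p : ℝ × ℂ in conePairs, P (p.1 * p.2)) (ρ : ℝ) :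
    ∃ t₀ : ℂ, ∀ t, ‖t - t₀‖ < ρ → P t := by
  obtain ⟨A, hA, B, hB, hAB⟩ := eventually_prod_iff.1 hP
  obtain ⟨δ, hδ, hball⟩ := Metric.eventually_nhds_iff.1 hB
  obtain ⟨r, hr, hr0, hrρ⟩ := (hA.and ((eventually_gt_atTop 0).and
    (eventually_gt_atTop (ρ / δ)))).exists
  have hr0' : (r : ℂ) ≠ 0 := by exact_mod_cast hr0.ne'
  -- Scaling the `δ`-ball about `dir` by `r` gives radius `r δ > ρ`.
  refine ⟨r * dir, fun t ht => ?_⟩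
  have h1 : B (t / r) := by
    apply hball
    rw [dist_eq_norm, show t / r - dir = (t - r * dir) / r by field_simp, norm_div,
      Complex.norm_real, Real.norm_of_nonneg hr0.le, div_lt_iff₀ hr0]
    rw [div_lt_iff₀ hδ] at hrρ
    linarith
  have := hAB hr h1
  rwa [show (r : ℂ) * (t / r) = t by field_simp] at this

/-! ### Realizing blocks on dense open sets -/

lemma occursAt_of_iter_sub_mem_cylinder {f : ℂ → GaussianInt} (hf : IsHurwitzChoice f)
    {β : List GaussianInt} {z : ℂ} {n : ℕ} {g : GaussianInt}
    (h : iter f z n - GaussianInt.toComplex g ∈ cylinder f β) :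
    OccursAt β (expansion f z) (n + 1) := by
  obtain ⟨⟨hre, him⟩, -, hocc⟩ := h
  have h1 : f (iter f z n) = g := hf.eq_of_abs_lt
    (by simpa using hre) (by simpa using him)
  have h2 : f (iter f z n - GaussianInt.toComplex g) = 0 := hf.eq_of_abs_lt
    (by simpa using hre) (by simpa using him)
  intro i hi
  rw [← hocc i hi, expansion, expansion, iter_add, iter_add, iter_add]
  simp only [iter, h1, h2, map_zero, sub_zero]

lemma exists_gaussianInt_norm_sub_le (z : ℂ) :
    ∃ g : GaussianInt, ‖z - GaussianInt.toComplex g‖ ≤ 1 := by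
  refine ⟨⟨round z.re, round z.im⟩, (Complex.norm_le_abs_re_add_abs_im _).trans ?_⟩
  have h1 := abs_sub_round z.re
  have h2 := abs_sub_round z.im
  simp only [Complex.sub_re, Complex.sub_im, gaussianInt_toComplex_re, gaussianInt_toComplex_im]
  linarith

lemma exists_gaussianInt_div_mem {U : Set ℂ} (hU : IsOpen U) (hne : U.Nonempty) :
    ∃ a c : GaussianInt, c ≠ 0 ∧ GaussianInt.toComplex a / GaussianInt.toComplex c ∈ U := by
  obtain ⟨z, hz⟩ := hne
  obtain ⟨ε, hε, hball⟩ := Metric.isOpen_iff.1 hU z hz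
  obtain ⟨n, hn⟩ := exists_nat_gt (1 / ε)
  have hn0 : (0 : ℝ) < n := lt_trans (by positivity) hn
  have hnC : (n : ℂ) ≠ 0 := by exact_mod_cast hn0.ne'
  obtain ⟨g, hg⟩ := exists_gaussianInt_norm_sub_le (n * z)
  refine ⟨g, n, by exact_mod_cast hn0.ne', hball ?_⟩
  rw [mem_ball_iff_norm', map_natCast, show z - GaussianInt.toComplex g / n =
    (n * z - GaussianInt.toComplex g) / n by field_simp, norm_div, Complex.norm_natCast,
    div_lt_iff₀ hn0]
  rw [div_lt_iff₀ hε] at hn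
  linarith

lemma dense_interior_occursAt {f : ℂ → GaussianInt} (hf : IsHurwitzChoice f)
    {β : List GaussianInt} (hβ : Admissible f β) :
    Dense (interior {z | ∃ k, OccursAt β (expansion f z) k}) := by
  obtain ⟨-, -, s, hs⟩ := hβ
  rw [dense_iff_inter_open]
  intro U hU hne
  obtain ⟨a, c, hc, hac⟩ := exists_gaussianInt_div_mem hU hne
  have hcC : GaussianInt.toComplex c ≠ 0 := by simpa using hc
  obtain ⟨n, u, v, hu, hn⟩ := exists_iter_moebius_eq_affine hf a 1 c 0 (by simpa using hc)
  simp only [map_one, map_zero, add_zero] at hn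
  set M : ℂ → ℂ := fun t => (GaussianInt.toComplex a * t + 1) / (GaussianInt.toComplex c * t)
    with hM
  have hMU : ∀ᶠ p : ℝ × ℂ in conePairs, M (p.1 * p.2) ∈ U := by
    have h1 := (tendsto_mul_moebius_sub (a := GaussianInt.toComplex a) (b := 1) (d := 0) hcC).1
    have h2 := (tendsto_inv_fst_conePairs.mul h1).add_const
      (GaussianInt.toComplex a / GaussianInt.toComplex c)
    rw [zero_mul, zero_add] at h2
    filter_upwards [h2.eventually (hU.mem_nhds hac),
      tendsto_fst_conePairs.eventually_gt_atTop 0] with p h3 h4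
    have h4' : (p.1 : ℂ) ≠ 0 := by exact_mod_cast h4.ne'
    rwa [inv_mul_cancel_left₀ h4', sub_add_cancel, add_zero] at h3
  have hne0 : ∀ᶠ p : ℝ × ℂ in conePairs, (p.1 * p.2 : ℂ) ≠ 0 := by
    simpa using (tendsto_mul_moebius_sub (a := 0) (b := 0) (c := 1) (d := 0) one_ne_zero).2
  have hu' : 0 < ‖u‖ := norm_pos_iff.2 hu
  -- The affine image of this ball has radius `3`. The target `g + s` lies within `2` of its centre:
  -- `1` for rounding to `g`, and less than `1` for `s`.
  obtain ⟨t₀, ht₀⟩ := exists_ball_of_eventually_conePairs (P := fun t =>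
    iter f (M t) n = u * t + v ∧ M t ∈ U ∧ t ≠ 0) (hn.and (hMU.and hne0)) (3 / ‖u‖)
  obtain ⟨g, hg⟩ := exists_gaussianInt_norm_sub_le (u * t₀ + v)
  -- the parameter at which the affine map takes the value `g + s`
  obtain ⟨t₁, ht₁⟩ : ∃ t₁, u * t₁ + v = GaussianInt.toComplex g + s :=
    ⟨(GaussianInt.toComplex g + s - v) / u, by field_simp; ring⟩
  have hs1 : ‖s‖ < 1 := by
    obtain ⟨h1, h2⟩ := (interior_subset hs).1
    have := Complex.norm_le_abs_re_add_abs_im s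
    linarith
  have hdist : ‖t₁ - t₀‖ < 3 / ‖u‖ := by
    rw [lt_div_iff₀ hu', ← norm_mul, show (t₁ - t₀) * u =
      s - (u * t₀ + v - GaussianInt.toComplex g) by linear_combination ht₁]
    exact (norm_sub_le _ _).trans_lt (by linarith)
  obtain ⟨-, hU1, ht0⟩ := ht₀ t₁ hdist
  refine ⟨M t₁, hU1, ?_⟩
  set w := GaussianInt.toComplex a / GaussianInt.toComplex c with hw
  -- `I` inverts `M` away from `t = 0`; its continuity at `M t₁` turns conditions on `t` into a
  -- neighbourhood of `M t₁`.
  set I : ℂ → ℂ := fun z => (GaussianInt.toComplex c * (z - w))⁻¹ with hI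
  have hMw : ∀ t, t ≠ 0 → GaussianInt.toComplex c * (M t - w) = t⁻¹ := by
    intro t ht
    simp only [hM, hw]
    field_simp
    ring
  have hIM : I (M t₁) = t₁ := by rw [hI]; simp only [hMw _ ht0, inv_inv]
  have hMI : ∀ z, I z ≠ 0 → M (I z) = z := by
    intro z hz
    have h1 := hMw (I z) hz
    rw [hI] at h1
    simp only [inv_inv] at h1
    have := mul_left_cancel₀ hcC h1
    exact sub_left_injective this
  have hcont : ContinuousAt I (M t₁) := by
    refine ContinuousAt.inv₀ (by fun_prop) ?_
    rw [hMw _ ht0]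
    exact inv_ne_zero ht0
  rw [mem_interior_iff_mem_nhds]
  have hc1 : ∀ᶠ z in 𝓝 (M t₁), ‖I z - t₀‖ < 3 / ‖u‖ := by
    have : ContinuousAt (fun z => ‖I z - t₀‖) (M t₁) := by fun_prop
    exact this.eventually_lt_const (by simpa only [hIM] using hdist)
  have hc2 : ∀ᶠ z in 𝓝 (M t₁), u * I z + v - GaussianInt.toComplex g ∈ cylinder f β := by
    have : ContinuousAt (fun z => u * I z + v - GaussianInt.toComplex g) (M t₁) := by fun_prop
    refine this.eventually_mem (mem_interior_iff_mem_nhds.1 ?_)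
    simpa only [hIM, ht₁, add_sub_cancel_left] using hs
  filter_upwards [hc1, hc2] with z h1 h2
  obtain ⟨h3, -, h4⟩ := ht₀ _ h1
  rw [hMI z h4] at h3
  rw [← h3] at h2
  exact ⟨n + 1, occursAt_of_iter_sub_mem_cylinder hf h2⟩

lemma isOpen_dense_re_ne (x : ℝ) : IsOpen {z : ℂ | z.re ≠ x} ∧ Dense {z : ℂ | z.re ≠ x} := by
  refine ⟨isOpen_ne_fun Complex.continuous_re continuous_const, ?_⟩
  have : {z : ℂ | z.re ≠ x} = Complex.re ⁻¹' {x}ᶜ := rfl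
  rw [this]
  exact (dense_compl_singleton x).preimage Complex.isOpenMap_re

end HurwitzCF

theorem proposition8p5 (f : ℂ → GaussianInt) (hf : HurwitzCF.IsHurwitzChoice f) :
    ∃ D : Set ℂ, IsGδ D ∧ Dense D ∧ D ⊆ HurwitzCF.genericNumbers f := by
  have : Countable GaussianInt :=
    Function.Injective.countable (f := fun g : GaussianInt => (g.re, g.im))
      fun x y h => Zsqrtd.ext (congrArg Prod.fst h) (congrArg Prod.snd h)
  let A : Set ℂ := ⋂ q : ℚ, {z : ℂ | z.re ≠ q}
  let B : Set ℂ := ⋂ β : {β : List GaussianInt // HurwitzCF.Admissible f β},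
    interior {z | ∃ k, HurwitzCF.OccursAt β.1 (HurwitzCF.expansion f z) k}
  have hA : IsGδ A := .iInter_of_isOpen fun q => (HurwitzCF.isOpen_dense_re_ne q).1
  have hB : IsGδ B := .iInter_of_isOpen fun _ => isOpen_interior
  refine ⟨A ∩ B, hA.inter hB, ?_, ?_⟩
  · refine Dense.inter_of_Gδ hA hB ?_ ?_
    · exact dense_iInter_of_isOpen (fun q => (HurwitzCF.isOpen_dense_re_ne q).1)
        fun q => (HurwitzCF.isOpen_dense_re_ne q).2
    · exact dense_iInter_of_isOpen (fun _ => isOpen_interior)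
        fun β => HurwitzCF.dense_interior_occursAt hf β.2
  · rintro z ⟨hzA, hzB⟩
    refine ⟨.inl ?_, fun β hβ => ?_⟩
    · rintro ⟨q, hq⟩
      exact Set.mem_iInter.1 hzA q hq.symm
    · have h : z ∈ {z | ∃ k, HurwitzCF.OccursAt β (HurwitzCF.expansion f z) k} :=
        interior_subset (Set.mem_iInter.1 hzB ⟨β, hβ⟩)
      exact h
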